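/- Let $\mathcal W=\operatorname{Spec}B$ and $\mathcal Z=\operatorname{Spec}A$ be two noetherian local normal schemes of dimension $2$ (that is, $A$ and $B$ are noetherian integrally closed local domains of Krull dimension $2$), with closed points $w$ and $z$ respectively, and let $\phi\colon\mathcal W\to\mathcal Z$ be a dominant finite morphism. Let $\Gamma_1\neq\Gamma_2$ be two distinct irreducible $\mathbb Q$-Cartier Weil divisors on $\mathcal W$, and put $\Delta_i:=\phi(\Gamma_i)$, an irreducible Weil divisor on $\mathcal Z$. Assume that $\phi^{-1}(\Delta_i)=\Gamma_i$ (as sets) for $i=1,2$, and let $e_{\Gamma_i/\Delta_i}$ be the ramification index of $\Gamma_i$ over $\Delta_i$, that is, of the extension of discrete valuation rings $\mathcal O_{\mathcal Z,\Delta_i}\subseteq\mathcal O_{\mathcal W,\Gamma_i}$; equivalently $\phi^*\Delta_i=e_{\Gamma_i/\Delta_i}\Gamma_i$. Then $\Delta_1$ and $\Delta_2$ are $\mathbb Q$-Cartier, and \[ \deg(\phi)\,(\Delta_1,\Delta_2)=e_{\Gamma_1/\Delta_1}\,e_{\Gamma_2/\Delta_2}\,[k(w):k(z)]\,(\Gamma_1,\Gamma_2).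 \] Here $\deg(\phi)=[K(\mathcal W):K(\mathcal Z)]$ is the degree of the extension of function fields, $k(w)$ and $k(z)$ are the residue fields at the closed points, and $(\cdot,\cdot)$ is the $\mathbb Q$-valued intersection number: for effective $\mathbb Q$-Cartier Weil divisors $D,D'$ without common component on a two-dimensional noetherian local normal scheme $\operatorname{Spec}R$, \[ (D,D')=\frac{1}{m\,m'}\operatorname{length}_R\bigl(R/(f,g)\bigr), \] where $m,m'\ge 1$ are integers and $f,g\in R$ are such that $\operatorname{div}(f)=mD$ and $\operatorname{div}(g)=m'D'$ (the value does not depend on the choices). -/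

import Mathlib

/-!
Divisors on a local normal scheme `Spec R` (`R` a noetherian normal local domain), and the
`ℚ`-valued intersection pairing at its closed point.
-/

namespace LocalSurface

/-- An irreducible Weil divisor of `Spec R`, recorded by its generic point, a prime of height one. -/
@[ext]
structure PrimeDivisor (R : Type*) [CommRing R] where
  /-- the generic point -/
  point : PrimeSpectrum R
  height_eq_one : point.asIdeal.height = 1

/-- The Weil divisors of `Spec R`. -/
abbrev WeilDivisor (R : Type*) [CommRing R] := PrimeDivisor R →₀ ℤ

section Divisors

variable {R : Type*} [CommRing R]

/-- The irreducible closed subset of `Spec R` underlying a prime divisor. -/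
def PrimeDivisor.carrier (P : PrimeDivisor R) : Set (PrimeSpectrum R) :=
  closure {P.point}

/-- The Weil divisor `1 · P`. -/
noncomputable def PrimeDivisor.toWeil (P : PrimeDivisor R) : WeilDivisor R :=
  Finsupp.single P 1

/-- The order of vanishing along `P` of a function `a ≠ 0` on `Spec R`: the length of
`𝒪_P / (a)`, where `𝒪_P` is the local ring at the generic point of `P`. -/
noncomputable def PrimeDivisor.ord (P : PrimeDivisor R) (a : R) : ℕ :=
  (Ring.ord (Localization.AtPrime P.point.asIdeal)
    (algebraMap R (Localization.AtPrime P.point.asIdeal) a)).toNat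

/-- `D` is Cartier: around every point it is the divisor of a nonzero rational function `a / b`. -/
def IsCartier (D : WeilDivisor R) : Prop :=
  ∀ x : PrimeSpectrum R, ∃ U : Set (PrimeSpectrum R), IsOpen U ∧ x ∈ U ∧
    ∃ a b : R, a ≠ 0 ∧ b ≠ 0 ∧
      ∀ P : PrimeDivisor R, P.point ∈ U → D P = (P.ord a : ℤ) - (P.ord b : ℤ)

/-- `D` is `ℚ`-Cartier: some positive multiple of it is Cartier. -/
def IsQCartier (D : WeilDivisor R) : Prop :=
  ∃ m : ℕ, 0 < m ∧ IsCartier (m • D)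

/-- The function `f` on `Spec R` defines the effective divisor `D`: `div f = D`. -/
def IsDefinedBy (D : WeilDivisor R) (f : R) : Prop :=
  f ≠ 0 ∧ ∀ P : PrimeDivisor R, D P = (P.ord f : ℤ)

/-- `(m, m', f, g)` consists of integers `m, m' > 0` and functions `f, g` with `div f = m D` and
`div g = m' D'`. -/
def IsCartierData (D D' : WeilDivisor R) (t : ℕ × ℕ × R × R) : Prop :=
  0 < t.1 ∧ 0 < t.2.1 ∧ IsDefinedBy (t.1 • D) t.2.2.1 ∧ IsDefinedBy (t.2.1 • D') t.2.2.2

/-- The length of `R / (f, g)`. -/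
noncomputable def localLength (f g : R) : ℕ :=
  (Module.length R (R ⧸ Ideal.span {f, g})).toNat

open scoped Classical in
/-- The `ℚ`-valued intersection number, at the closed point of a two-dimensional local normal
scheme `Spec R`, of effective `ℚ`-Cartier divisors `D`, `D'` without common component:
`(D, D') = (m D, m' D') / (m m')`, where `m D = div f` and `m' D' = div g` are Cartier and
`(m D, m' D')` is the length of `R / (f, g)`. On a local scheme a Cartier divisor is principal
(the only neighbourhood of the closed point is the whole scheme), and on a normal scheme an
effective principal divisor is the divisor of a regular function, so for such `D`, `D'` suitable
`m, m', f, g` exist; the value does not depend on them. -/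
noncomputable def intersectionNumber (D D' : WeilDivisor R) : ℚ :=
  if h : ∃ t : ℕ × ℕ × R × R, IsCartierData D D' t then
    (localLength h.choose.2.2.1 h.choose.2.2.2 : ℚ) / ((h.choose.1 : ℚ) * (h.choose.2.1 : ℚ))
  else 0

end Divisors

section Morphism

/-- The map on points of the morphism `φ : Spec B ⟶ Spec A` given by the `A`-algebra `B`. -/
def specMap (A B : Type*) [CommRing A] [CommRing B] [Algebra A B] :
    PrimeSpectrum B → PrimeSpectrum A :=
  PrimeSpectrum.comap (algebraMap A B)

variable {A B : Type*} [CommRing A] [IsDomain A] [IsNoetherianRing A]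
  [IsIntegrallyClosed A]
  [CommRing B] [IsDomain B] [IsNoetherianRing B] [Algebra A B] [Module.Finite A B]

/-- Under a dominant finite morphism to a normal scheme, the image of a point of codimension one
has codimension one. -/
theorem height_specMap (hφ : DenseRange (specMap A B)) (P : PrimeDivisor B) :
    (specMap A B P.point).asIdeal.height = 1 := by
  have hinj : Function.Injective (algebraMap A B) := by
    rw [RingHom.injective_iff_ker_eq_bot, ← le_bot_iff]
    refine ((PrimeSpectrum.denseRange_comap_iff_ker_le_nilRadical _).mp hφ).trans ?_
    rw [nilradical_eq_zero]
    exact le_rfl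
  have : FaithfulSMul A B := (faithfulSMul_iff_algebraMap_injective A B).mpr hinj
  have hlo : P.point.asIdeal.LiesOver (specMap A B P.point).asIdeal := ⟨rfl⟩
  have hle := Ideal.height_eq_height_add_of_liesOver_of_hasGoingDown
    (specMap A B P.point).asIdeal P.point.asIdeal
  rw [P.height_eq_one] at hle
  apply le_antisymm
  · rw [hle]
    exact le_self_add
  · rw [Order.one_le_iff_ne_zero, Ne, Ideal.height_eq_zero_iff_eq_bot]
    exact Ideal.under_ne_bot A (Ideal.ne_bot_of_height_eq_one P.height_eq_one)

/-- The irreducible divisor `φ(Γ)`, image of `Γ` under a dominant finite morphism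
`φ : Spec B ⟶ Spec A` (its generic point is the image of that of `Γ`). -/
def PrimeDivisor.image (hφ : DenseRange (specMap A B)) (P : PrimeDivisor B) : PrimeDivisor A where
  point := specMap A B P.point
  height_eq_one := height_specMap hφ P

/-- The underlying closed set of `φ(Γ)` is the image of that of `Γ`. -/
theorem PrimeDivisor.carrier_image (hφ : DenseRange (specMap A B)) (P : PrimeDivisor B) :
    (P.image hφ).carrier = specMap A B '' P.carrier := by
  have hcl : IsClosedMap (specMap A B) :=
    PrimeSpectrum.isClosedMap_comap_of_isIntegral _ (algebraMap_isIntegral_iff.mpr inferInstance)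
  have hc : Continuous (specMap A B) := PrimeSpectrum.continuous_comap (algebraMap A B)
  have h := hcl.closure_image_eq_of_continuous hc {P.point}
  rw [Set.image_singleton] at h
  exact h

end Morphism

end LocalSurface

open LocalSurface

/-! The same pair of functions computes both sides. If `div(f) = mΓ` with `m > 0`, the norm of `f`
has divisor a positive multiple of `Δ = φ(Γ)`, so `Δ` is `ℚ`-Cartier. Conversely, if `div(g) = nΔ`,
then `φ⁻¹(Δ) = Γ` forces the pullback of `g` to have divisor `neΓ`. With `g₁, g₂` defining multiples
of `Δ₁, Δ₂`, the factors `e₁e₂` come from the denominators, and it remains to show `deg(φ) ·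
ℓ_A(A/(g₁,g₂)) = [k(w):k(z)] · ℓ_B(B/(g₁,g₂))`. The right side is `ℓ_A(B/(g₁,g₂))`.

Flatness of `B` over `A` is not needed. For a finite torsion-free `A`-module `M` on which `f, g` is
a regular sequence, with `V(f) = V(p)` and `A_p` a discrete valuation ring,
`Module.length_quotient_pair` gives `ℓ(M/(f,g)M) = rank(M) · ord_p(f) · ℓ(A/(p,g))`; taking `M = A`
and `M = B` and comparing finishes the proof. The formula is a dévissage: on modules supported on
`V(p) = {p, 𝔪}` the Euler characteristic `ℓ(N/gN) - ℓ(ker g)` is additive by the snake lemma, so it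
is determined by its values on `A/p` and `A/𝔪`. For `N = M/fM` the kernel vanishes, and `N_p` has
length `rank(M) · ord_p(f)`.

Regularity holds on `A` and on `B` because in a normal domain divisibility is tested at height-one
primes (`dvd_of_ord_le`). -/

/-! ### Lengths and Euler characteristics of multiplication maps -/

open LinearMap in
/-- For an endomorphism of a short exact sequence, the lengths of the kernels and cokernels have
alternating sum zero, and the length of the kernels is subadditive. -/
theorem Module.length_ker_add_length_coker_of_exact {R N₁ N₂ N₃ : Type*} [CommRing R]
    [AddCommGroup N₁] [Module R N₁] [AddCommGroup N₂] [Module R N₂] [AddCommGroup N₃] [Module R N₃]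
    {f : N₁ →ₗ[R] N₂} {g : N₂ →ₗ[R] N₃} (hf : Function.Injective f) (hg : Function.Surjective g)
    (hfg : Function.Exact f g)
    {i₁ : N₁ →ₗ[R] N₁} {i₂ : N₂ →ₗ[R] N₂} {i₃ : N₃ →ₗ[R] N₃}
    (h₁ : f.comp i₁ = i₂.comp f) (h₂ : g.comp i₂ = i₃.comp g) :
    Module.length R (N₁ ⧸ range i₁) + Module.length R (N₃ ⧸ range i₃) +
        Module.length R (ker i₂) =
      Module.length R (N₂ ⧸ range i₂) + (Module.length R (ker i₁) + Module.length R (ker i₃)) ∧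
    Module.length R (ker i₂) ≤ Module.length R (ker i₁) + Module.length R (ker i₃) := by
  let a : ker i₁ →ₗ[R] ker i₂ := f.restrict fun x hx ↦ by
    rw [mem_ker] at hx ⊢
    rw [← comp_apply, ← h₁, comp_apply, hx, map_zero]
  let b : ker i₂ →ₗ[R] ker i₃ := g.restrict fun x hx ↦ by
    rw [mem_ker] at hx ⊢
    rw [← comp_apply, ← h₂, comp_apply, hx, map_zero]
  let c : (N₁ ⧸ range i₁) →ₗ[R] (N₂ ⧸ range i₂) := Submodule.mapQ _ _ f <| by
    rintro _ ⟨x, rfl⟩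
    exact ⟨f x, (LinearMap.congr_fun h₁ x).symm⟩
  let d : (N₂ ⧸ range i₂) →ₗ[R] (N₃ ⧸ range i₃) := Submodule.mapQ _ _ g <| by
    rintro _ ⟨x, rfl⟩
    exact ⟨g x, (LinearMap.congr_fun h₂ x).symm⟩
  have e₁ : Function.Exact (ker i₁).subtype i₁ := exact_subtype_ker_map i₁
  have e₂ : Function.Exact (ker i₂).subtype i₂ := exact_subtype_ker_map i₂
  have e₃ : Function.Exact (ker i₃).subtype i₃ := exact_subtype_ker_map i₃
  have q₁ : Function.Exact i₁ (range i₁).mkQ := exact_map_mkQ_range i₁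
  have q₂ : Function.Exact i₂ (range i₂).mkQ := exact_map_mkQ_range i₂
  let δ := SnakeLemma.δ' i₁ i₂ i₃ f g hfg f g hfg h₁ h₂ (ker i₃).subtype e₃ (range i₁).mkQ q₁ hg hf
  have hδr : Function.Exact b δ :=
    SnakeLemma.exact_δ'_right i₁ i₂ i₃ f g hfg f g hfg h₁ h₂ (ker i₂).subtype
    e₂ (ker i₃).subtype e₃ (range i₁).mkQ q₁ hg hf b rfl (Submodule.subtype_injective _)
  have hδl : Function.Exact δ c :=
    SnakeLemma.exact_δ'_left i₁ i₂ i₃ f g hfg f g hfg h₁ h₂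
    (ker i₃).subtype e₃ (range i₁).mkQ q₁ (range i₂).mkQ q₂ hg hf c rfl (Submodule.mkQ_surjective _)
  have ha : Function.Injective a := fun x y h ↦ Subtype.ext (hf congr($h.1))
  have hd : Function.Surjective d := by
    intro x
    obtain ⟨x, rfl⟩ := Submodule.mkQ_surjective _ x
    obtain ⟨x, rfl⟩ := hg x
    exact ⟨Submodule.mkQ _ x, rfl⟩
  have hab : Function.Exact a b := by
    intro x
    constructor
    · intro hx
      obtain ⟨y, hy⟩ := (hfg x.1).mp congr($hx.1)
      refine ⟨⟨y, hf ?_⟩, Subtype.ext hy⟩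
      rw [← comp_apply, h₁, comp_apply, hy, map_zero]
      exact x.2
    · rintro ⟨y, rfl⟩
      exact Subtype.ext (hfg.apply_apply_eq_zero y.1)
  have hcd : Function.Exact c d := by
    intro x
    constructor
    · intro hx
      obtain ⟨x, rfl⟩ := Submodule.mkQ_surjective _ x
      obtain ⟨z, hz⟩ := (Submodule.Quotient.mk_eq_zero _).mp hx
      obtain ⟨z, rfl⟩ := hg z
      obtain ⟨y, hy⟩ := (hfg (x - i₂ z)).mp <| by
        rw [map_sub, sub_eq_zero, ← hz]
        exact (LinearMap.congr_fun h₂ z).symm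
      refine ⟨Submodule.mkQ _ y, (Submodule.Quotient.eq _).mpr ⟨-z, ?_⟩⟩
      rw [hy, map_neg]
      abel
    · rintro ⟨y, rfl⟩
      obtain ⟨y, rfl⟩ := Submodule.mkQ_surjective _ y
      exact (Submodule.Quotient.mk_eq_zero _).mpr (by
        rw [hfg.apply_apply_eq_zero]
        exact zero_mem _)
  -- The six-term kernel-cokernel sequence is cut into short exact pieces at the images of `b`, `δ`
  -- and `c`. The first two pieces alone give the inequality.
  have l₁ := Module.length_eq_add_of_exact a b.rangeRestrict ha b.surjective_rangeRestrict
    (fun x ↦ by rw [← hab x, Subtype.ext_iff]; rfl)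
  have l₂ := Module.length_eq_add_of_exact (range b).subtype δ.rangeRestrict
    (Submodule.subtype_injective _) δ.surjective_rangeRestrict
    (fun x ↦ by
      rw [Subtype.ext_iff]
      exact (hδr x).trans ⟨fun ⟨y, hy⟩ ↦ ⟨⟨_, y, rfl⟩, hy⟩, fun ⟨⟨_, y, hy⟩, h⟩ ↦ ⟨y, hy.trans h⟩⟩)
  have l₃ := Module.length_eq_add_of_exact (range δ).subtype c.rangeRestrict
    (Submodule.subtype_injective _) c.surjective_rangeRestrict
    (fun x ↦ by
      rw [Subtype.ext_iff]
      exact (hδl x).trans ⟨fun ⟨y, hy⟩ ↦ ⟨⟨_, y, rfl⟩, hy⟩, fun ⟨⟨_, y, hy⟩, h⟩ ↦ ⟨y, hy.trans h⟩⟩)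
  have l₄ := Module.length_eq_add_of_exact (range c).subtype d
    (Submodule.subtype_injective _) hd
    (fun x ↦ (hcd x).trans
      ⟨fun ⟨y, hy⟩ ↦ ⟨⟨_, y, rfl⟩, hy⟩, fun ⟨⟨_, y, hy⟩, h⟩ ↦ ⟨y, hy.trans h⟩⟩)
  refine ⟨?_, ?_⟩
  · rw [l₁, l₂, l₃, l₄]
    abel
  · rw [l₁, l₂]
    gcongr
    exact le_self_add

/-- The length of the localization at a prime is additive in short exact sequences. -/
theorem Module.length_localizedModule_eq_add_of_exact {R N₁ N₂ N₃ : Type*} [CommRing R]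
    [AddCommGroup N₁] [Module R N₁] [AddCommGroup N₂] [Module R N₂] [AddCommGroup N₃] [Module R N₃]
    {f : N₁ →ₗ[R] N₂} {g : N₂ →ₗ[R] N₃} (hf : Function.Injective f) (hg : Function.Surjective g)
    (hfg : Function.Exact f g) (S : Submonoid R) :
    Module.length (Localization S) (LocalizedModule S N₂) =
      Module.length (Localization S) (LocalizedModule S N₁) +
        Module.length (Localization S) (LocalizedModule S N₃) :=
  Module.length_eq_add_of_exact (LocalizedModule.map S f) (LocalizedModule.map S g)
    (LocalizedModule.map_injective S f hf) (LocalizedModule.map_surjective S g hg)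
    (LocalizedModule.map_exact S f g hfg)

/-- For a prime ideal `p`, the localization of `R ⧸ p` at `p` has length one. -/
theorem Module.length_localizedModule_quotient_self {R : Type*} [CommRing R] (p : Ideal R)
    [p.IsPrime] :
    Module.length (Localization p.primeCompl) (LocalizedModule p.primeCompl (R ⧸ p)) = 1 := by
  let e := (IsLocalizedModule.linearEquiv p.primeCompl
    (Submodule.toLocalizedQuotient' (Localization p.primeCompl) p.primeCompl
      (Algebra.linearMap R (Localization p.primeCompl)) p)
    (LocalizedModule.mkLinearMap p.primeCompl (R ⧸ p))).extendScalarsOfIsLocalization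
      p.primeCompl (Localization p.primeCompl)
  rw [← e.length_eq, Submodule.localized'_eq_span]
  have : Submodule.span (Localization p.primeCompl)
      (Algebra.linearMap R (Localization p.primeCompl) '' p) =
      IsLocalRing.maximalIdeal (Localization.AtPrime p) :=
    Localization.AtPrime.map_eq_maximalIdeal
  rw [Module.length_eq_one_iff, this, isSimpleModule_iff_isCoatom, ← Ideal.isMaximal_def]
  exact IsLocalRing.maximalIdeal.isMaximal _

/-- The length of `M ⧸ a M` for a free module `M`. -/
theorem Module.length_quotient_range_lsmul {R M : Type*} [CommRing R] [Nontrivial R]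
    [AddCommGroup M] [Module R M] [Module.Free R M] [Module.Finite R M] (a : R) :
    Module.length R (M ⧸ LinearMap.range (LinearMap.lsmul R M a)) =
      Module.finrank R M * Ring.ord R a := by
  let b := Module.Free.chooseBasis R M
  let π : M →ₗ[R] (Module.Free.ChooseBasisIndex R M → R ⧸ Ideal.span {a}) :=
    LinearMap.pi fun i ↦ (Ideal.span {a}).mkQ ∘ₗ b.coord i
  have hπ : Function.Surjective π := by
    intro y
    choose z hz using fun i ↦ Submodule.mkQ_surjective _ (y i)
    refine ⟨b.equivFun.symm z, funext fun i ↦ ?_⟩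
    change Submodule.mkQ _ (b.repr (b.equivFun.symm z) i) = y i
    rw [← b.equivFun_apply, LinearEquiv.apply_symm_apply, hz]
  have hker : LinearMap.ker π = LinearMap.range (LinearMap.lsmul R M a) := by
    ext x
    constructor
    · intro hx
      have h : ∀ i, ∃ c, c * a = b.repr x i := fun i ↦ by
        have := congrFun (LinearMap.mem_ker.mp hx) i
        exact Ideal.mem_span_singleton'.mp ((Submodule.Quotient.mk_eq_zero _).mp this)
      choose c hc using h
      refine ⟨b.equivFun.symm c, b.repr.injective (Finsupp.ext fun i ↦ ?_)⟩
      rw [LinearMap.lsmul_apply, map_smul, Finsupp.smul_apply, ← b.equivFun_apply,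
        LinearEquiv.apply_symm_apply, ← hc, smul_eq_mul, mul_comm]
    · rintro ⟨x, rfl⟩
      refine LinearMap.mem_ker.mpr (funext fun i ↦ (Submodule.Quotient.mk_eq_zero _).mpr ?_)
      simpa using Ideal.mul_mem_right _ _ (Ideal.mem_span_singleton_self a)
  rw [← hker, (π.quotKerEquivOfSurjective hπ).length_eq, Module.length_pi,
    Module.finrank_eq_card_chooseBasisIndex, ENat.card_eq_coe_fintype_card]
  rfl

/-- The localization of `M ⧸ a M` at a prime `p` for which `R_p` is a discrete valuation ring. -/
theorem Module.length_localizedModule_quotient_range_lsmul {R M : Type*} [CommRing R] [IsDomain R]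
    [AddCommGroup M] [Module R M] [Module.IsTorsionFree R M] [Module.Finite R M]
    (p : Ideal R) [p.IsPrime] [IsDiscreteValuationRing (Localization.AtPrime p)] (a : R) :
    Module.length (Localization p.primeCompl)
        (LocalizedModule p.primeCompl (M ⧸ LinearMap.range (LinearMap.lsmul R M a))) =
      Module.finrank R M * Ring.ord (Localization.AtPrime p) (algebraMap R _ a) := by
  have hp : p.primeCompl ≤ nonZeroDivisors R := p.primeCompl_le_nonZeroDivisors
  -- A finite torsion-free module over a discrete valuation ring is free, so the formula for free
  -- modules applies to `M_p`.
  have htf : Module.IsTorsionFree (Localization.AtPrime p) (LocalizedModule p.primeCompl M) := by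
    infer_instance
  have hfr : Module.finrank (Localization.AtPrime p) (LocalizedModule p.primeCompl M) =
      Module.finrank R M := by
    rw [IsLocalization.finrank_eq (Localization.AtPrime p) p.primeCompl hp,
      IsLocalizedModule.finrank_eq p.primeCompl (LocalizedModule.mkLinearMap p.primeCompl M) hp]
  rw [← hfr, ← Module.length_quotient_range_lsmul, ← (localizedQuotientEquiv p.primeCompl
    (LinearMap.range (LinearMap.lsmul R M a))).length_eq]
  refine LinearEquiv.length_eq (Submodule.quotEquivOfEq _ _ ?_)
  ext x
  rw [Submodule.mem_localized']
  constructor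
  · rintro ⟨_, ⟨n, rfl⟩, s, rfl⟩
    refine ⟨IsLocalizedModule.mk' (LocalizedModule.mkLinearMap p.primeCompl M) n s, ?_⟩
    rw [LinearMap.lsmul_apply, LinearMap.lsmul_apply, algebraMap_smul, IsLocalizedModule.mk'_smul]
  · rintro ⟨y, rfl⟩
    obtain ⟨⟨n, s⟩, rfl⟩ :=
      IsLocalizedModule.mk'_surjective p.primeCompl (LocalizedModule.mkLinearMap p.primeCompl M) y
    refine ⟨a • n, ⟨n, rfl⟩, s, ?_⟩
    rw [LinearMap.lsmul_apply, algebraMap_smul, IsLocalizedModule.mk'_smul]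
    rfl

/-- A finite module `N` over a noetherian local ring with support in `V(p)`, where `V(p)` consists
of `p` and the maximal ideal: for `a` in the maximal ideal and not in `p`,
`ℓ(N / a N) - ℓ(ker (a | N)) = ℓ(N_p) · ℓ(R / (p, a))`. -/
theorem Module.length_quotient_range_lsmul_of_support {R N : Type*} [CommRing R] [IsLocalRing R]
    [IsNoetherianRing R] [AddCommGroup N] [Module R N] [Module.Finite R N]
    (p : Ideal R) [p.IsPrime] (hpm : p ≠ IsLocalRing.maximalIdeal R)
    (hp : ∀ q : Ideal R, q.IsPrime → p ≤ q → q = p ∨ q = IsLocalRing.maximalIdeal R)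
    {a : R} (ha : a ∈ IsLocalRing.maximalIdeal R) (hap : a ∉ p)
    (hN : ∀ q ∈ Module.support R N, p ≤ q.asIdeal) :
    Module.length R (N ⧸ LinearMap.range (LinearMap.lsmul R N a)) =
      Module.length R (LinearMap.ker (LinearMap.lsmul R N a)) +
        Module.length (Localization p.primeCompl) (LocalizedModule p.primeCompl N) *
          Module.length R ((R ⧸ p) ⧸ LinearMap.range (LinearMap.lsmul R (R ⧸ p) a)) := by
  set c := Module.length R ((R ⧸ p) ⧸ LinearMap.range (LinearMap.lsmul R (R ⧸ p) a))
  -- Finiteness of the kernel's length is carried through the induction, since cancellation in `ℕ∞`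
  -- requires it.
  suffices h : Module.length R (LinearMap.ker (LinearMap.lsmul R N a)) ≠ ⊤ ∧
      Module.length R (N ⧸ LinearMap.range (LinearMap.lsmul R N a)) =
        Module.length R (LinearMap.ker (LinearMap.lsmul R N a)) +
          Module.length (Localization p.primeCompl) (LocalizedModule p.primeCompl N) * c from h.2
  have hfin : Module.Finite R N := inferInstance
  revert hN
  induction hfin using IsNoetherianRing.induction_on_isQuotientEquivQuotientPrime R with
  | subsingleton N =>
    intro _
    have : Subsingleton (LocalizedModule p.primeCompl N) := inferInstance
    simp [Module.length_eq_zero]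
  | quotient N q e =>
    intro hN
    have hq : p ≤ q.asIdeal := hN q <| by
      rw [e.support_eq, Module.mem_support_iff_of_finite, Ideal.annihilator_quotient]
    have hker := (LinearEquiv.submoduleMap e (LinearMap.ker (LinearMap.lsmul R N a))).length_eq
    have hk : (LinearMap.ker (LinearMap.lsmul R N a)).map e.toLinearMap =
        LinearMap.ker (LinearMap.lsmul R (R ⧸ q.asIdeal) a) := by
      ext x
      constructor
      · rintro ⟨y, hy, rfl⟩
        have hy : a • y = 0 := hy
        exact (map_smul e a y).symm.trans (by rw [hy, map_zero])
      · intro hx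
        have hx : a • x = 0 := hx
        exact ⟨e.symm x, (map_smul e.symm a x).symm.trans (by rw [hx, map_zero]),
          e.apply_symm_apply x⟩
    have hr : (LinearMap.range (LinearMap.lsmul R N a)).map e.toLinearMap =
        LinearMap.range (LinearMap.lsmul R (R ⧸ q.asIdeal) a) := by
      ext x
      constructor
      · rintro ⟨_, ⟨y, rfl⟩, rfl⟩
        exact ⟨e y, (map_smul e a y).symm⟩
      · rintro ⟨y, rfl⟩
        exact ⟨a • e.symm y, ⟨e.symm y, rfl⟩, by simp⟩
    have hcok := (Submodule.Quotient.equiv _ _ e hr).length_eq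
    rw [hk] at hker
    have hloc : Module.length (Localization p.primeCompl) (LocalizedModule p.primeCompl N) =
        Module.length (Localization p.primeCompl)
          (LocalizedModule p.primeCompl (R ⧸ q.asIdeal)) :=
      le_antisymm
        (Module.length_le_of_injective (LocalizedModule.map p.primeCompl e.toLinearMap)
          (LocalizedModule.map_injective _ _ e.injective))
        (Module.length_le_of_surjective (LocalizedModule.map p.primeCompl e.toLinearMap)
          (LocalizedModule.map_surjective _ _ e.surjective))
    rw [hker, hcok, hloc]
    -- For `q = p`, `a` is a nonzerodivisor on the domain `R/p`. For `q` maximal, `a` acts as zero,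
    -- so kernel and cokernel are both `R/q`, and the localization at `p` vanishes.
    rcases hp _ q.isPrime hq with h | h
    · have hker0 : LinearMap.ker (LinearMap.lsmul R (R ⧸ q.asIdeal) a) = ⊥ := by
        rw [LinearMap.ker_eq_bot']
        intro x hx
        obtain ⟨x, rfl⟩ := Ideal.Quotient.mk_surjective x
        have hx : Ideal.Quotient.mk q.asIdeal (a * x) = 0 := hx
        rw [Ideal.Quotient.eq_zero_iff_mem] at hx ⊢
        exact (q.isPrime.mem_or_mem hx).resolve_left (h ▸ hap)
      rw [hker0, Module.length_bot, zero_add, h, Module.length_localizedModule_quotient_self,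
        one_mul]
      exact ⟨ENat.zero_ne_top, rfl⟩
    · have hzero : LinearMap.lsmul R (R ⧸ q.asIdeal) a = 0 := by
        ext
        exact Ideal.Quotient.eq_zero_iff_mem.mpr (Ideal.mul_mem_right _ _ (h ▸ ha))
      have hsub : Subsingleton (LocalizedModule p.primeCompl (R ⧸ q.asIdeal)) := by
        refine Module.notMem_support_iff (p := ⟨p, inferInstance⟩) |>.mp ?_
        rw [Module.mem_support_iff_of_finite, Ideal.annihilator_quotient, h]
        exact fun hle ↦ hpm (le_antisymm (hq.trans h.le) hle)
      rw [hzero, LinearMap.ker_zero, LinearMap.range_zero, Module.length_top,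
        (Submodule.quotEquivOfEqBot _ rfl).length_eq,
        Module.length_eq_zero (M := LocalizedModule _ _), zero_mul, add_zero]
      refine ⟨?_, rfl⟩
      have hmax : q.asIdeal.IsMaximal := h ▸ IsLocalRing.maximalIdeal.isMaximal R
      rw [Module.length_eq_one_iff.mpr (isSimpleModule_iff_isCoatom.mpr hmax.out)]
      exact ENat.one_ne_top
  | exact N₁ N₂ N₃ f g hf hg hfg h₁ h₃ =>
    intro hN
    rw [Module.support_of_exact hfg hf hg] at hN
    obtain ⟨k₁, e₁⟩ := h₁ fun q hq ↦ hN q (Or.inl hq)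
    obtain ⟨k₃, e₃⟩ := h₃ fun q hq ↦ hN q (Or.inr hq)
    obtain ⟨hs, hle⟩ := Module.length_ker_add_length_coker_of_exact hf hg hfg
      (i₁ := LinearMap.lsmul R N₁ a) (i₂ := LinearMap.lsmul R N₂ a) (i₃ := LinearMap.lsmul R N₃ a)
      (by ext; simp) (by ext; simp)
    have hK : Module.length R (LinearMap.ker (LinearMap.lsmul R N₁ a)) +
        Module.length R (LinearMap.ker (LinearMap.lsmul R N₃ a)) ≠ ⊤ := by
      simp only [ne_eq, ENat.add_eq_top, k₁, k₃, or_self, not_false_eq_true]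
    refine ⟨(hle.trans_lt hK.lt_top).ne, ?_⟩
    rw [e₁, e₃] at hs
    rw [Module.length_localizedModule_eq_add_of_exact hf hg hfg, add_mul]
    refine (ENat.add_left_injective_of_ne_top hK ?_).symm
    dsimp only
    rw [← hs]
    abel

/-- The length of `M / (f, g) M` for a torsion free module `M` on which `f, g` is a regular
sequence, where `V(f)` is the closure `V(p)` of a point `p` at which the ring is a discrete
valuation ring. -/
theorem Module.length_quotient_pair {R M Q : Type*} [CommRing R] [IsDomain R] [IsLocalRing R]
    [IsNoetherianRing R] [AddCommGroup M] [Module R M] [Module.Finite R M]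
    [Module.IsTorsionFree R M] [AddCommGroup Q] [Module R Q]
    (p : Ideal R) [p.IsPrime] [IsDiscreteValuationRing (Localization.AtPrime p)]
    (hpm : p ≠ IsLocalRing.maximalIdeal R)
    (hp : ∀ q : Ideal R, q.IsPrime → p ≤ q → q = p ∨ q = IsLocalRing.maximalIdeal R)
    {f g : R} (hf : ∀ x ∈ p, ∃ k : ℕ, f ∣ x ^ k)
    (hg : g ∈ IsLocalRing.maximalIdeal R) (hgp : g ∉ p)
    (hreg : ∀ x y : M, g • x = f • y → ∃ z, x = f • z)
    (π : M →ₗ[R] Q) (hπ : Function.Surjective π)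
    (hker : ∀ m, π m = 0 ↔ ∃ x y, m = f • x + g • y) :
    Module.length R Q =
      Module.finrank R M * Ring.ord (Localization.AtPrime p) (algebraMap R _ f) *
        Ring.ord (R ⧸ p) (Ideal.Quotient.mk p g) := by
  let N := M ⧸ LinearMap.range (LinearMap.lsmul R M f)
  have hsupp : ∀ q ∈ Module.support R N, p ≤ q.asIdeal := by
    intro q hq x hx
    obtain ⟨k, y, hk⟩ := hf x hx
    refine q.isPrime.mem_of_pow_mem k (Module.annihilator_le_of_mem_support hq ?_)
    rw [Module.mem_annihilator]
    intro n
    obtain ⟨n, rfl⟩ := Submodule.mkQ_surjective _ n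
    rw [← map_smul, hk, mul_smul]
    exact (Submodule.Quotient.mk_eq_zero _).mpr ⟨y • n, rfl⟩
  have hker0 : LinearMap.ker (LinearMap.lsmul R N g) = ⊥ := by
    rw [LinearMap.ker_eq_bot']
    intro n hn
    obtain ⟨n, rfl⟩ := Submodule.mkQ_surjective _ n
    obtain ⟨y, hy⟩ := (Submodule.Quotient.mk_eq_zero _).mp
      ((map_smul (Submodule.mkQ _) g n).trans hn)
    obtain ⟨z, rfl⟩ := hreg n y hy.symm
    exact (Submodule.Quotient.mk_eq_zero _).mpr ⟨z, rfl⟩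
  have h := Module.length_quotient_range_lsmul_of_support (N := N) p hpm hp hg hgp hsupp
  rw [hker0, Module.length_bot, zero_add, Module.length_localizedModule_quotient_range_lsmul] at h
  have hord : Module.length R ((R ⧸ p) ⧸ LinearMap.range (LinearMap.lsmul R (R ⧸ p) g)) =
      Ring.ord (R ⧸ p) (Ideal.Quotient.mk p g) := by
    rw [Ring.ord, ← Module.length_eq_of_surjective (S := R) (R := R ⧸ p)
      Ideal.Quotient.mk_surjective]
    let e := Submodule.quotEquivOfEq (LinearMap.range (LinearMap.lsmul R (R ⧸ p) g))
      ((Ideal.span {Ideal.Quotient.mk p g}).restrictScalars R) <| by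
        ext x
        rw [Submodule.restrictScalars_mem, Ideal.mem_span_singleton']
        exact ⟨fun ⟨y, hy⟩ ↦ ⟨y, by rw [← hy, mul_comm]; rfl⟩,
          fun ⟨y, hy⟩ ↦ ⟨y, by rw [← hy, mul_comm]; rfl⟩⟩
    exact e.length_eq
  rw [hord] at h
  rw [← h]
  -- `Q` and the iterated quotient `N/gN` are both quotients of `M` by `fM + gM`.
  let ρ : M →ₗ[R] N ⧸ LinearMap.range (LinearMap.lsmul R N g) :=
    Submodule.mkQ _ ∘ₗ Submodule.mkQ _
  have hρ : Function.Surjective ρ :=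
    (Submodule.mkQ_surjective _).comp (Submodule.mkQ_surjective _)
  have hkers : LinearMap.ker π = LinearMap.ker ρ := by
    ext m
    rw [LinearMap.mem_ker, LinearMap.mem_ker, hker]
    constructor
    · rintro ⟨x, y, rfl⟩
      refine (Submodule.Quotient.mk_eq_zero _).mpr ⟨Submodule.mkQ _ y, ?_⟩
      rw [map_add, LinearMap.lsmul_apply, ← map_smul, right_eq_add]
      exact (Submodule.Quotient.mk_eq_zero _).mpr ⟨x, rfl⟩
    · intro hm
      obtain ⟨y, hy⟩ := (Submodule.Quotient.mk_eq_zero _).mp hm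
      obtain ⟨y, rfl⟩ := Submodule.mkQ_surjective _ y
      rw [LinearMap.lsmul_apply, ← map_smul] at hy
      obtain ⟨x, hx⟩ := (Submodule.Quotient.eq _).mp hy
      refine ⟨-x, y, ?_⟩
      rw [LinearMap.lsmul_apply] at hx
      rw [smul_neg, hx]
      abel
  rw [← (π.quotKerEquivOfSurjective hπ).length_eq, ← (ρ.quotKerEquivOfSurjective hρ).length_eq,
    hkers]

/-! ### Orders of vanishing and divisibility on a normal scheme -/

namespace LocalSurface

variable {R : Type*} [CommRing R]

instance PrimeDivisor.isPrime (P : PrimeDivisor R) : P.point.asIdeal.IsPrime := P.point.isPrime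

theorem IsDefinedBy.ord_self {P : PrimeDivisor R} {m : ℕ} {f : R}
    (h : IsDefinedBy (m • P.toWeil) f) : P.ord f = m := by
  have := h.2 P
  rw [Finsupp.smul_apply, PrimeDivisor.toWeil, Finsupp.single_eq_same, nsmul_one] at this
  exact_mod_cast this.symm

theorem IsDefinedBy.ord_of_ne {P Q : PrimeDivisor R} (hQ : Q ≠ P) {m : ℕ} {f : R}
    (h : IsDefinedBy (m • P.toWeil) f) : Q.ord f = 0 := by
  have := h.2 Q
  rw [Finsupp.smul_apply, PrimeDivisor.toWeil, Finsupp.single_eq_of_ne hQ, nsmul_zero] at this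
  exact_mod_cast this.symm

theorem isDefinedBy_of_ord {P : PrimeDivisor R} {m : ℕ} {f : R} (hf : f ≠ 0) (hP : P.ord f = m)
    (hQ : ∀ Q : PrimeDivisor R, Q ≠ P → Q.ord f = 0) : IsDefinedBy (m • P.toWeil) f := by
  refine ⟨hf, fun Q ↦ ?_⟩
  rw [Finsupp.smul_apply, PrimeDivisor.toWeil]
  by_cases h : Q = P
  · rw [h, Finsupp.single_eq_same, nsmul_one, hP]
  · rw [Finsupp.single_eq_of_ne h, nsmul_zero, hQ Q h, Nat.cast_zero]

section Domain

variable [IsDomain R]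

theorem PrimeDivisor.eq_of_le {P : PrimeDivisor R} {q : Ideal R} [q.IsPrime] (hq : q ≠ ⊥)
    (h : q ≤ P.point.asIdeal) : q = P.point.asIdeal := by
  have hfin : P.point.asIdeal.FiniteHeight := by
    rw [Ideal.finiteHeight_iff, P.height_eq_one]
    exact Or.inr ENat.one_ne_top
  by_contra hne
  have hlt := Ideal.height_strict_mono_of_isPrime_of_isPrime (lt_of_le_of_ne h hne)
  rw [P.height_eq_one, Order.lt_one_iff, Ideal.height_eq_zero_iff_eq_bot] at hlt
  exact hq hlt

end Domain

section Normal

variable [IsDomain R] [IsNoetherianRing R] [IsIntegrallyClosed R]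

/-- A normal scheme is regular in codimension one. -/
instance PrimeDivisor.isDiscreteValuationRing (P : PrimeDivisor R) :
    IsDiscreteValuationRing (Localization.AtPrime P.point.asIdeal) := by
  have hic : IsIntegrallyClosed (Localization.AtPrime P.point.asIdeal) :=
    isIntegrallyClosed_of_isLocalization _ _ P.point.asIdeal.primeCompl_le_nonZeroDivisors
  have hmap := Localization.AtPrime.map_eq_maximalIdeal (I := P.point.asIdeal)
  have hinj : Function.Injective (algebraMap R (Localization.AtPrime P.point.asIdeal)) :=
    IsLocalization.injective _ P.point.asIdeal.primeCompl_le_nonZeroDivisors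
  have hpir : IsPrincipalIdealRing (Localization.AtPrime P.point.asIdeal) := by
    -- Item 3 says integrally closed with no nonzero prime but the maximal ideal; item 0 says
    -- principal ideal ring. Height one supplies the condition on primes.
    have htfae := (tfae_of_isNoetherianRing_of_isLocalRing_of_isDomain
      (Localization.AtPrime P.point.asIdeal)).out 3 0
    refine htfae.mp ⟨hic, fun Q hQ hQp ↦ ?_⟩
    have hle : Q.under R ≤ P.point.asIdeal := by
      exact (Ideal.comap_mono (IsLocalRing.le_maximalIdeal hQp.ne_top)).trans
        Localization.AtPrime.under_maximalIdeal.le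
    have hne : Q.under R ≠ ⊥ := fun h ↦ hQ <| by
      rw [← IsLocalization.map_under P.point.asIdeal.primeCompl _ Q, h, Ideal.map_bot]
    refine (IsLocalization.map_under P.point.asIdeal.primeCompl _ Q).symm.trans ?_
    exact (congrArg (Ideal.map _) (PrimeDivisor.eq_of_le hne hle)).trans hmap
  refine { not_a_field' := fun h ↦ Ideal.ne_bot_of_height_eq_one P.height_eq_one ?_ }
  rw [h] at hmap
  exact (Ideal.map_eq_bot_iff_of_injective hinj).mp hmap

theorem PrimeDivisor.coe_ord (P : PrimeDivisor R) {a : R} (ha : a ≠ 0) :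
    (P.ord a : ℕ∞) = Ring.ord (Localization.AtPrime P.point.asIdeal) (algebraMap R _ a) := by
  refine ENat.natCast_toNat (Ring.ord_ne_top (mem_nonZeroDivisors_of_ne_zero ?_))
  exact (map_ne_zero_iff _ (IsLocalization.injective _
    P.point.asIdeal.primeCompl_le_nonZeroDivisors)).mpr ha

theorem PrimeDivisor.ord_mul (P : PrimeDivisor R) {a b : R} (ha : a ≠ 0) (hb : b ≠ 0) :
    P.ord (a * b) = P.ord a + P.ord b := by
  have h : (P.ord (a * b) : ℕ∞) = P.ord a + P.ord b := by
    rw [P.coe_ord ha, P.coe_ord hb, P.coe_ord (mul_ne_zero ha hb), map_mul, Ring.ord_eq_addVal,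
      Ring.ord_eq_addVal, Ring.ord_eq_addVal, IsDiscreteValuationRing.addVal_mul]
  exact_mod_cast h

theorem PrimeDivisor.ord_pow (P : PrimeDivisor R) {a : R} (ha : a ≠ 0) (n : ℕ) :
    P.ord (a ^ n) = n * P.ord a := by
  induction n with
  | zero => simp [PrimeDivisor.ord]
  | succ n ih => rw [pow_succ, P.ord_mul (pow_ne_zero n ha) ha, ih, add_mul, one_mul]

/-- The valuation ring at `P` contains `a / b`; `s` is a denominator of this element. -/
theorem PrimeDivisor.dvd_of_ord_le (P : PrimeDivisor R) {a b : R} (ha : a ≠ 0) (hb : b ≠ 0)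
    (h : P.ord b ≤ P.ord a) : ∃ s ∉ P.point.asIdeal, b ∣ s * a := by
  have h' : (P.ord b : ℕ∞) ≤ P.ord a := by exact_mod_cast h
  rw [P.coe_ord ha, P.coe_ord hb, Ring.ord_eq_addVal, Ring.ord_eq_addVal,
    IsDiscreteValuationRing.addVal_le_iff_dvd] at h'
  obtain ⟨c, hc⟩ := h'
  obtain ⟨⟨d, s⟩, rfl⟩ := IsLocalization.mk'_surjective P.point.asIdeal.primeCompl c
  refine ⟨s, s.2, d, IsLocalization.injective (Localization.AtPrime P.point.asIdeal)
    P.point.asIdeal.primeCompl_le_nonZeroDivisors ?_⟩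
  rw [map_mul, map_mul, hc, mul_left_comm]
  exact congrArg _ (IsLocalization.mk'_spec' _ d s)

theorem PrimeDivisor.ord_eq_zero_iff (P : PrimeDivisor R) {a : R} (ha : a ≠ 0) :
    P.ord a = 0 ↔ a ∉ P.point.asIdeal := by
  rw [← ENat.natCast_inj, P.coe_ord ha, Ring.ord, Nat.cast_zero, Module.length_eq_zero_iff,
    Ideal.Quotient.subsingleton_iff, Ideal.span_singleton_eq_top,
    IsLocalization.AtPrime.isUnit_to_map_iff _ P.point.asIdeal]
  rfl

/-- A function that vanishes at least as much as `b` along every prime divisor is a multiple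
of `b`. -/
theorem dvd_of_ord_le {a b : R} (ha : a ≠ 0) (hb : b ≠ 0)
    (h : ∀ P : PrimeDivisor R, P.ord b ≤ P.ord a) : b ∣ a := by
  by_contra hba
  have ha' : Ideal.Quotient.mk (Ideal.span {b}) a ≠ 0 := by
    rwa [ne_eq, Ideal.Quotient.eq_zero_iff_mem, Ideal.mem_span_singleton]
  -- If `a ∉ bR`, the annihilator of its class lies in an associated prime `q = (b : d)` of `R/bR`.
  -- Normality forces `q` to have height one, where the hypothesis on orders gives a contradiction.
  obtain ⟨q, hq, haq⟩ := exists_le_isAssociatedPrime_of_isNoetherianRing R _ ha'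
  rw [isAssociatedPrime_iff] at hq
  obtain ⟨hqp, d, hd⟩ := hq
  obtain ⟨d, rfl⟩ := Ideal.Quotient.mk_surjective d
  have hmem : ∀ e x : R, x ∈ (⊥ : Submodule R (R ⧸ Ideal.span {b})).colon
      {Ideal.Quotient.mk (Ideal.span {b}) e} ↔ b ∣ x * e := by
    intro e x
    rw [Submodule.mem_colon_singleton, Submodule.mem_bot, ← Ideal.mem_span_singleton,
      ← Ideal.Quotient.eq_zero_iff_mem]
    rfl
  have hqd : ∀ x, x ∈ q ↔ b ∣ x * d := fun x ↦ by rw [hd, hmem]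
  have hbq : b ∈ q := (hqd b).mpr (dvd_mul_right b d)
  have hht : q.height = 1 := by
    have hy : ∃ y ∈ q, ∃ t ∉ q, y * d = b * t := by
      -- Otherwise `d / b` maps the finitely generated ideal `q` into itself, hence is integral over
      -- `R`, hence lies in `R`; then `1 ∈ q`.
      by_contra! hy
      have hint : IsIntegral R (algebraMap R (FractionRing R) d / algebraMap R _ b) := by
        have hb' : algebraMap R (FractionRing R) b ≠ 0 := IsFractionRing.to_map_eq_zero_iff.not.mpr hb
        refine isIntegral_of_smul_mem_submodule
          (Submodule.map (Algebra.linearMap R (FractionRing R)) q) ?_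
          (Submodule.FG.map _ (IsNoetherian.noetherian _)) _ ?_
        · rw [Submodule.ne_bot_iff]
          exact ⟨_, ⟨b, hbq, rfl⟩, hb'⟩
        · rintro _ ⟨y, hyq, rfl⟩
          obtain ⟨t, ht⟩ := (hqd y).mp hyq
          refine ⟨t, by_contra fun htq ↦ hy y hyq t htq ht, ?_⟩
          rw [Algebra.linearMap_apply, Algebra.linearMap_apply, smul_eq_mul, div_mul_eq_mul_div,
            eq_div_iff hb', ← map_mul, ← map_mul, mul_comm t, ← ht, mul_comm]
      obtain ⟨c, hc⟩ := IsIntegrallyClosed.algebraMap_eq_of_integral hint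
      refine hqp.ne_top ((Ideal.eq_top_iff_one _).mpr ((hqd 1).mpr ⟨c, ?_⟩))
      have hb' : algebraMap R (FractionRing R) b ≠ 0 := IsFractionRing.to_map_eq_zero_iff.not.mpr hb
      rw [eq_div_iff hb', ← map_mul] at hc
      rw [one_mul, ← IsFractionRing.injective R (FractionRing R) hc, mul_comm]
    obtain ⟨y, hyq, t, htq, hyt⟩ := hy
    apply le_antisymm
    -- Krull's principal ideal theorem: `q` is minimal over `y`, because `t m ∈ yR` for every `m ∈
    -- q` while `t ∉ q`.
    · refine Ideal.height_le_one_of_isPrincipal_of_mem_minimalPrimes (Ideal.span {y}) q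
        ⟨⟨hqp, (Ideal.span_singleton_le_iff_mem _).mpr hyq⟩, ?_⟩
      rintro q' ⟨hq'p, hyq'⟩ hle m hm
      obtain ⟨k, hk⟩ := (hqd m).mp hm
      have htm : t * m = k * y := by
        refine mul_left_cancel₀ hb ?_
        linear_combination (-m) * hyt + y * hk
      exact (hq'p.mem_or_mem (htm ▸ Ideal.mul_mem_left _ k
        ((Ideal.span_singleton_le_iff_mem _).mp hyq') : t * m ∈ q')).resolve_left fun h ↦ htq (hle h)
    · rw [Order.one_le_iff_ne_zero, ne_eq, Ideal.height_eq_zero_iff_eq_bot]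
      rintro rfl
      exact hb hbq
  obtain ⟨s, hs, hsa⟩ := (⟨⟨q, hqp⟩, hht⟩ : PrimeDivisor R).dvd_of_ord_le ha hb (h _)
  exact hs (haq ((hmem a s).mpr hsa))

/-- A `ℚ`-Cartier effective divisor on a local normal scheme has a multiple defined by a
function. -/
theorem IsQCartier.exists_isDefinedBy [IsLocalRing R] {P : PrimeDivisor R}
    (h : IsQCartier P.toWeil) : ∃ m : ℕ, 0 < m ∧ ∃ f : R, IsDefinedBy (m • P.toWeil) f := by
  obtain ⟨m, hm, h⟩ := h
  obtain ⟨U, hU, hxU, a, b, ha, hb, hD⟩ := h (IsLocalRing.closedPoint R)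
  -- Every point specializes to the closed point, so a neighbourhood of the latter is the whole
  -- scheme.
  have hUtop : ∀ x, x ∈ U := by
    intro x
    exact (PrimeSpectrum.le_iff_specializes _ _).mp
      (IsLocalRing.le_maximalIdeal x.isPrime.ne_top) |>.mem_open hU hxU
  have hnn : ∀ Q : PrimeDivisor R, 0 ≤ (m • P.toWeil) Q := by
    intro Q
    rw [Finsupp.smul_apply, PrimeDivisor.toWeil]
    refine nsmul_nonneg ?_ m
    classical
    rw [Finsupp.single_apply]
    split_ifs <;> simp
  obtain ⟨f, rfl⟩ := dvd_of_ord_le ha hb fun Q ↦ by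
    have := hD Q (hUtop _)
    have := hnn Q
    omega
  refine ⟨m, hm, f, right_ne_zero_of_mul ha, fun Q ↦ ?_⟩
  rw [hD Q (hUtop _), Q.ord_mul hb (right_ne_zero_of_mul ha)]
  push_cast
  ring

omit [IsNoetherianRing R] [IsIntegrallyClosed R] in
theorem IsDefinedBy.isCartier {D : WeilDivisor R} {f : R} (h : IsDefinedBy D f) : IsCartier D :=
  fun _ ↦ ⟨Set.univ, isOpen_univ, Set.mem_univ _, f, 1, h.1, one_ne_zero, fun P _ ↦ by
    simp [h.2 P, PrimeDivisor.ord]⟩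

theorem IsDefinedBy.pow {P : PrimeDivisor R} {m : ℕ} {f : R} (h : IsDefinedBy (m • P.toWeil) f)
    (n : ℕ) : IsDefinedBy ((n * m) • P.toWeil) (f ^ n) :=
  isDefinedBy_of_ord (pow_ne_zero n h.1) (by rw [P.ord_pow h.1, h.ord_self])
    fun Q hQ ↦ by rw [Q.ord_pow h.1, h.ord_of_ne hQ, mul_zero]

/-- Equal orders give divisibility both ways. This underlies the independence of the intersection
number from the choices. -/
theorem IsDefinedBy.associated {D : WeilDivisor R} {f g : R} (hf : IsDefinedBy D f)
    (hg : IsDefinedBy D g) : Associated f g := by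
  have h : ∀ P : PrimeDivisor R, P.ord f = P.ord g := fun P ↦ by
    exact_mod_cast (hf.2 P).symm.trans (hg.2 P)
  exact associated_of_dvd_dvd (dvd_of_ord_le hg.1 hf.1 fun P ↦ (h P).le)
    (dvd_of_ord_le hf.1 hg.1 fun P ↦ (h P).ge)

/-- A function defining a multiple of `P` divides a power of every function vanishing on `P`. -/
theorem IsDefinedBy.exists_dvd_pow {P : PrimeDivisor R} {m : ℕ} {f x : R}
    (h : IsDefinedBy (m • P.toWeil) f) (hx : x ∈ P.point.asIdeal) : ∃ k : ℕ, f ∣ x ^ k := by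
  by_cases hx0 : x = 0
  · exact ⟨1, by simp [hx0]⟩
  -- The exponent `m` suffices, as `x` has order at least one along `P`.
  refine ⟨m, dvd_of_ord_le (pow_ne_zero m hx0) h.1 fun Q ↦ ?_⟩
  by_cases hQ : Q = P
  · rw [hQ, h.ord_self, P.ord_pow hx0]
    exact Nat.le_mul_of_pos_right m (Nat.pos_of_ne_zero fun h0 ↦ (P.ord_eq_zero_iff hx0).mp h0 hx)
  · rw [h.ord_of_ne hQ]
    exact Nat.zero_le _

/-- Functions defining multiples of distinct prime divisors form a regular sequence. -/
theorem IsDefinedBy.dvd_of_mul_eq_mul {P Q : PrimeDivisor R} (hPQ : P ≠ Q) {m n : ℕ} {f g x y : R}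
    (hf : IsDefinedBy (m • P.toWeil) f) (hg : IsDefinedBy (n • Q.toWeil) g)
    (h : g * x = f * y) : f ∣ x := by
  by_cases hx : x = 0
  · rw [hx]
    exact dvd_zero f
  have hy : y ≠ 0 := right_ne_zero_of_mul (h ▸ mul_ne_zero hg.1 hx)
  refine dvd_of_ord_le hx hf.1 fun Q' ↦ ?_
  by_cases hQ : Q' = P
  · have := congrArg P.ord h
    rw [P.ord_mul hg.1 hx, P.ord_mul hf.1 hy, hg.ord_of_ne hPQ] at this
    rw [hQ]
    omega
  · rw [hf.ord_of_ne hQ]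
    exact Nat.zero_le _

end Normal

/-! ### Dimension two: lengths and the intersection number -/

section Local

variable [IsLocalRing R]

theorem PrimeDivisor.ne_maximalIdeal (hR : ringKrullDim R = 2) (P : PrimeDivisor R) :
    P.point.asIdeal ≠ IsLocalRing.maximalIdeal R := by
  intro h
  have := P.height_eq_one
  rw [h, ← WithBot.coe_inj, IsLocalRing.maximalIdeal_height_eq_ringKrullDim, hR] at this
  exact absurd this (by decide)

/-- A prime strictly in between would have height strictly between 1 and 2. -/
theorem PrimeDivisor.eq_or_eq_maximalIdeal (hR : ringKrullDim R = 2) (P : PrimeDivisor R)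
    (q : Ideal R) (hq : q.IsPrime) (hle : P.point.asIdeal ≤ q) :
    q = P.point.asIdeal ∨ q = IsLocalRing.maximalIdeal R := by
  by_contra! hne
  have hm : (IsLocalRing.maximalIdeal R).height = 2 := by
    rw [← WithBot.coe_inj, IsLocalRing.maximalIdeal_height_eq_ringKrullDim, hR]
    rfl
  have hfin : (IsLocalRing.maximalIdeal R).FiniteHeight := by
    rw [Ideal.finiteHeight_iff, hm]
    exact Or.inr (by decide)
  have h₁ := Ideal.height_strict_mono_of_isPrime_of_isPrime
    (lt_of_le_of_ne (IsLocalRing.le_maximalIdeal hq.ne_top) hne.2)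
  have hqfin : q.FiniteHeight := by
    rw [Ideal.finiteHeight_iff]
    exact Or.inr (h₁.trans_le le_top).ne
  have h₂ := Ideal.height_strict_mono_of_isPrime_of_isPrime (lt_of_le_of_ne hle hne.1.symm)
  rw [P.height_eq_one] at h₂
  rw [hm] at h₁
  have h₃ : (1 : ℕ∞) + 1 ≤ q.height := Order.add_one_le_of_lt h₂
  exact absurd (h₃.trans_lt h₁) (by decide)

variable [IsDomain R] [IsNoetherianRing R] [IsIntegrallyClosed R]

/-- The length of `M / (f, g) M`, where `f` and `g` define multiples of distinct prime divisors. -/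
theorem IsDefinedBy.length_eq (hR : ringKrullDim R = 2) {P Q : PrimeDivisor R} (hPQ : P ≠ Q)
    {m n : ℕ} (hn : 0 < n) {f g : R} (hf : IsDefinedBy (m • P.toWeil) f)
    (hg : IsDefinedBy (n • Q.toWeil) g)
    {M M' : Type*} [AddCommGroup M] [Module R M] [Module.Finite R M] [Module.IsTorsionFree R M]
    [AddCommGroup M'] [Module R M'] (hreg : ∀ x y : M, g • x = f • y → ∃ z, x = f • z)
    (π : M →ₗ[R] M') (hπ : Function.Surjective π)
    (hker : ∀ x, π x = 0 ↔ ∃ y z, x = f • y + g • z) :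
    (Module.length R M').toNat = Module.finrank R M * m *
      (Ring.ord (R ⧸ P.point.asIdeal) (Ideal.Quotient.mk _ g)).toNat := by
  have hgQ : g ∈ Q.point.asIdeal := by
    by_contra h
    rw [← Q.ord_eq_zero_iff hg.1, hg.ord_self] at h
    omega
  -- `ENat.toNat` sends `⊤` to `0` and is multiplicative on all of `ℕ∞`, so no finiteness of lengths
  -- has to be shown.
  rw [Module.length_quotient_pair P.point.asIdeal (P.ne_maximalIdeal hR)
    (P.eq_or_eq_maximalIdeal hR) (fun x ↦ hf.exists_dvd_pow)
    (IsLocalRing.le_maximalIdeal Q.point.isPrime.ne_top hgQ)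
    ((P.ord_eq_zero_iff hg.1).mp (hg.ord_of_ne hPQ)) hreg π hπ hker, ← P.coe_ord hf.1,
    hf.ord_self, ENat.toNat_mul, ENat.toNat_mul, ENat.toNat_natCast, ENat.toNat_natCast]

/-- The rank-one case `M = R`. The function `f` enters only through `m`, so independence of the
choices has to be checked for `g` alone. -/
theorem IsDefinedBy.localLength_eq (hR : ringKrullDim R = 2) {P Q : PrimeDivisor R} (hPQ : P ≠ Q)
    {m n : ℕ} (hn : 0 < n) {f g : R} (hf : IsDefinedBy (m • P.toWeil) f)
    (hg : IsDefinedBy (n • Q.toWeil) g) :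
    localLength f g =
      m * (Ring.ord (R ⧸ P.point.asIdeal) (Ideal.Quotient.mk _ g)).toNat := by
  rw [localLength, hf.length_eq hR hPQ hn hg (fun x y h ↦ hf.dvd_of_mul_eq_mul hPQ hg h)
    (Submodule.mkQ (Ideal.span {f, g})) (Submodule.mkQ_surjective _), Module.finrank_self, one_mul]
  intro x
  rw [Submodule.mkQ_apply, Submodule.Quotient.mk_eq_zero, Ideal.mem_span_pair]
  simp only [smul_eq_mul, mul_comm, eq_comm]

/-- The intersection number is computed by any functions defining multiples of the divisors. -/
theorem intersectionNumber_eq (hR : ringKrullDim R = 2) {P Q : PrimeDivisor R} (hPQ : P ≠ Q)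
    {m n : ℕ} (hm : 0 < m) (hn : 0 < n) {f g : R} (hf : IsDefinedBy (m • P.toWeil) f)
    (hg : IsDefinedBy (n • Q.toWeil) g) :
    intersectionNumber P.toWeil Q.toWeil = (localLength f g : ℚ) / (m * n) := by
  have h : ∃ t : ℕ × ℕ × R × R, IsCartierData P.toWeil Q.toWeil t := ⟨(m, n, f, g), hm, hn, hf, hg⟩
  rw [intersectionNumber, dif_pos h]
  obtain ⟨hm', hn', hf', hg'⟩ := h.choose_spec
  generalize h.choose = t at hm' hn' hf' hg' ⊢
  obtain ⟨m', n', f', g'⟩ := t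
  dsimp only at hm' hn' hf' hg' ⊢
  rw [hf.localLength_eq hR hPQ hn hg, hf'.localLength_eq hR hPQ hn' hg']
  have hord : ∀ {g : R}, g ≠ 0 → P.ord g = 0 → ∀ k : ℕ,
      (Ring.ord (R ⧸ P.point.asIdeal) (Ideal.Quotient.mk _ (g ^ k))).toNat =
        k * (Ring.ord (R ⧸ P.point.asIdeal) (Ideal.Quotient.mk _ g)).toNat := by
    intro g hg0 hg k
    rw [map_pow, Ring.ord_pow, nsmul_eq_mul, ENat.toNat_mul, ENat.toNat_natCast]
    rw [mem_nonZeroDivisors_iff_ne_zero, ne_eq, Ideal.Quotient.eq_zero_iff_mem]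
    exact (P.ord_eq_zero_iff hg0).mp hg
  -- Both `g ^ n'` and `g' ^ n` define `n n' Q`, so they differ by a unit.
  have key : n' * (Ring.ord (R ⧸ P.point.asIdeal) (Ideal.Quotient.mk _ g)).toNat =
      n * (Ring.ord (R ⧸ P.point.asIdeal) (Ideal.Quotient.mk _ g')).toNat := by
    rw [← hord hg.1 (hg.ord_of_ne hPQ), ← hord hg'.1 (hg'.ord_of_ne hPQ)]
    have h' := hg'.pow n
    rw [mul_comm] at h'
    rw [Ring.ord_eq_of_associated (((hg.pow n').associated h').map (Ideal.Quotient.mk _))]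
  have key' : (n' : ℚ) * (Ring.ord (R ⧸ P.point.asIdeal) (Ideal.Quotient.mk _ g)).toNat =
      n * (Ring.ord (R ⧸ P.point.asIdeal) (Ideal.Quotient.mk _ g')).toNat := by exact_mod_cast key
  have h₁ : (m : ℚ) ≠ 0 := by positivity
  have h₂ : (n : ℚ) ≠ 0 := by positivity
  have h₃ : (m' : ℚ) ≠ 0 := by positivity
  have h₄ : (n' : ℚ) ≠ 0 := by positivity
  push_cast
  rw [div_eq_div_iff (by positivity) (by positivity)]
  linear_combination (-(m : ℚ) * m') * key'

end Local

end LocalSurface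

/-! ### Pullback and norm along a finite dominant morphism -/

namespace LocalSurface

/-- A dominant morphism of integral affine schemes is given by an injective ring homomorphism. -/
theorem faithfulSMul_of_denseRange {A B : Type*} [CommRing A] [IsDomain A] [CommRing B]
    [Algebra A B] (hφ : DenseRange (specMap A B)) : FaithfulSMul A B := by
  rw [faithfulSMul_iff_algebraMap_injective, RingHom.injective_iff_ker_eq_bot, ← le_bot_iff]
  refine ((PrimeSpectrum.denseRange_comap_iff_ker_le_nilRadical _).mp hφ).trans ?_
  rw [nilradical_eq_zero]
  exact le_rfl
variable {A B : Type*} [CommRing A] [IsDomain A] [IsNoetherianRing A] [IsIntegrallyClosed A]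
  [CommRing B] [IsDomain B] [IsNoetherianRing B] [Algebra A B] [Module.Finite A B]

variable (hφ : DenseRange (specMap A B)) {Γ : PrimeDivisor B}

/-- The generic point of `Q` lies over that of `φ(Γ)`, hence in `φ⁻¹(φ(Γ)) = Γ`, and a height-one
prime contains no smaller nonzero prime. This keeps other components out of pulled-back divisors. -/
theorem PrimeDivisor.eq_of_image_eq (hpre : specMap A B ⁻¹' (Γ.image hφ).carrier = Γ.carrier)
    {Q : PrimeDivisor B} (hQ : Q.image hφ = Γ.image hφ) : Q = Γ := by
  have hmem : Q.point ∈ specMap A B ⁻¹' (Γ.image hφ).carrier := by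
    rw [Set.mem_preimage, ← hQ]
    exact subset_closure (Set.mem_singleton _)
  rw [hpre, PrimeDivisor.carrier, ← specializes_iff_mem_closure,
    ← PrimeSpectrum.le_iff_specializes] at hmem
  exact PrimeDivisor.ext (PrimeSpectrum.ext
    (PrimeDivisor.eq_of_le (Ideal.ne_bot_of_height_eq_one Γ.height_eq_one) hmem).symm)

variable [IsIntegrallyClosed B]

/-- The order of the pullback of a function is its order times the ramification index. -/
theorem PrimeDivisor.ord_algebraMap (P : PrimeDivisor B) {a : A} (ha : a ≠ 0) :
    P.ord (algebraMap A B a) = P.point.asIdeal.ramificationIdx A * (P.image hφ).ord a := by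
  have := faithfulSMul_of_denseRange hφ
  have hinj := FaithfulSMul.algebraMap_injective A B
  let p := (P.image hφ).point.asIdeal
  let q := P.point.asIdeal
  have hqp : q.LiesOver p := ⟨rfl⟩
  have hp : p.IsPrime := PrimeDivisor.isPrime _
  have hq : q.IsPrime := PrimeDivisor.isPrime _
  have hdp : IsDiscreteValuationRing (Localization.AtPrime p) :=
    PrimeDivisor.isDiscreteValuationRing (P.image hφ)
  have hdq : IsDiscreteValuationRing (Localization.AtPrime q) :=
    PrimeDivisor.isDiscreteValuationRing P
  let := Localization.AtPrime.algebraOfLiesOver p q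
  obtain ⟨ϖ, hϖ⟩ := IsDiscreteValuationRing.exists_irreducible (Localization.AtPrime p)
  have ha' : algebraMap A (Localization.AtPrime p) a ≠ 0 :=
    (map_ne_zero_iff _ (IsLocalization.injective _ p.primeCompl_le_nonZeroDivisors)).mpr ha
  obtain ⟨m, u, hu⟩ := IsDiscreteValuationRing.eq_unit_mul_pow_irreducible ha' hϖ
  have hm : (P.image hφ).ord a = m := by
    have h := (P.image hφ).coe_ord ha
    change _ = Ring.ord (Localization.AtPrime p) _ at h
    rw [hu, Ring.ord_mul_of_isUnit_left u.isUnit, Ring.ord_pow, Ring.ord_of_irreducible hϖ,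
      nsmul_one] at h
    · exact_mod_cast h
    · exact mem_nonZeroDivisors_of_ne_zero hϖ.ne_zero
  -- A nonzero `t ∈ p` is a multiple of `ϖ` in `A_p`, and its image in `B_q` is nonzero.
  have hϖ' : algebraMap (Localization.AtPrime p) (Localization.AtPrime q) ϖ ≠ 0 := by
    intro h
    obtain ⟨t, htp, ht⟩ := Submodule.exists_mem_ne_zero_of_ne_bot
      (Ideal.ne_bot_of_height_eq_one (P.image hφ).height_eq_one)
    have htm : algebraMap A (Localization.AtPrime p) t ∈ IsLocalRing.maximalIdeal _ :=
      Localization.AtPrime.map_eq_maximalIdeal (I := p) ▸ Ideal.mem_map_of_mem _ htp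
    rw [hϖ.maximalIdeal_eq, Ideal.mem_span_singleton] at htm
    obtain ⟨c, hc⟩ := htm
    have h0 : algebraMap A (Localization.AtPrime q) t = 0 := by
      rw [IsScalarTower.algebraMap_apply A (Localization.AtPrime p) (Localization.AtPrime q), hc,
        map_mul, h, zero_mul]
    rw [IsScalarTower.algebraMap_apply A B (Localization.AtPrime q)] at h0
    exact ht (hinj (IsLocalization.injective (Localization.AtPrime q)
      q.primeCompl_le_nonZeroDivisors (by rw [h0, map_zero, map_zero])))
  have he : P.point.asIdeal.ramificationIdx A = (Ring.ord (Localization.AtPrime q)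
      (algebraMap (Localization.AtPrime p) (Localization.AtPrime q) ϖ)).toNat := by
    rw [Ideal.ramificationIdx_eq p q, Ring.ord,
      IsScalarTower.algebraMap_eq A (Localization.AtPrime p) (Localization.AtPrime q),
      ← Ideal.map_map, Localization.AtPrime.map_eq_maximalIdeal, hϖ.maximalIdeal_eq,
      Ideal.map_span, Set.image_singleton]
  have h : P.ord (algebraMap A B a) = (Ring.ord (Localization.AtPrime q)
      (algebraMap A (Localization.AtPrime q) a)).toNat := by
    rw [IsScalarTower.algebraMap_apply A B (Localization.AtPrime q)]
    rfl
  rw [h, hm, he, IsScalarTower.algebraMap_apply A (Localization.AtPrime p) (Localization.AtPrime q),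
    hu, map_mul, map_pow, Ring.ord_mul_of_isUnit_left (u.isUnit.map _), Ring.ord_pow,
    nsmul_eq_mul, ENat.toNat_mul, ENat.toNat_natCast, mul_comm]
  exact mem_nonZeroDivisors_of_ne_zero hϖ'

/-- If `f` defines `m φ(Γ)`, then its pullback defines `m e Γ`, where `e` is the ramification
index. -/
theorem IsDefinedBy.pullback (hpre : specMap A B ⁻¹' (Γ.image hφ).carrier = Γ.carrier)
    {m : ℕ} {f : A} (hf : IsDefinedBy (m • (Γ.image hφ).toWeil) f) :
    IsDefinedBy ((Γ.point.asIdeal.ramificationIdx A * m) • Γ.toWeil) (algebraMap A B f) := by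
  have := faithfulSMul_of_denseRange hφ
  refine isDefinedBy_of_ord
    ((map_ne_zero_iff _ (FaithfulSMul.algebraMap_injective A B)).mpr hf.1) ?_ fun Q hQ ↦ ?_
  · rw [Γ.ord_algebraMap hφ hf.1, hf.ord_self]
  · rw [Q.ord_algebraMap hφ hf.1,
      hf.ord_of_ne fun h ↦ hQ (PrimeDivisor.eq_of_image_eq hφ hpre h), mul_zero]

/-- The norm of a function defining a multiple of `Γ` defines a multiple of the image of `Γ`. -/
theorem IsDefinedBy.exists_image {m : ℕ} (hm : 0 < m) {f : B} (hf : IsDefinedBy (m • Γ.toWeil) f) :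
    ∃ n : ℕ, 0 < n ∧ ∃ g : A, IsDefinedBy (n • (Γ.image hφ).toWeil) g := by
  have := faithfulSMul_of_denseRange hφ
  let := FractionRing.liftAlgebra A (FractionRing B)
  have hfin : FiniteDimensional (FractionRing A) (FractionRing B) :=
    .of_isLocalization A B (nonZeroDivisors A)
  have hne : ∀ {x : B}, x ≠ 0 → Algebra.intNorm A B x ≠ 0 := Algebra.intNorm_ne_zero.mpr
  have hfΓ : f ∈ Γ.point.asIdeal := by
    by_contra h
    rw [← Γ.ord_eq_zero_iff hf.1, hf.ord_self] at h
    omega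
  have hmem : Algebra.intNorm A B f ∈ (Γ.image hφ).point.asIdeal :=
    Γ.point.asIdeal.mem_of_dvd (Algebra.dvd_algebraMap_intNorm_self A B f) hfΓ
  refine ⟨(Γ.image hφ).ord (Algebra.intNorm A B f), Nat.pos_of_ne_zero fun h ↦
    ((Γ.image hφ).ord_eq_zero_iff (hne hf.1)).mp h hmem, Algebra.intNorm A B f,
    isDefinedBy_of_ord (hne hf.1) rfl fun Q hQ ↦ ?_⟩
  rw [Q.ord_eq_zero_iff (hne hf.1)]
  -- With `t` vanishing on `φ(Γ)` but not on `Q`, `f` divides some `t ^ k` in `B`. Taking norms,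
  -- `N(f)` divides a power of `t`, so it does not vanish on `Q`.
  obtain ⟨t, htΓ, htQ⟩ : ∃ t ∈ (Γ.image hφ).point.asIdeal, t ∉ Q.point.asIdeal := by
    by_contra! h
    exact hQ (PrimeDivisor.ext (PrimeSpectrum.ext (PrimeDivisor.eq_of_le
      (Ideal.ne_bot_of_height_eq_one (Γ.image hφ).height_eq_one) h).symm))
  obtain ⟨k, hk⟩ := hf.exists_dvd_pow (x := algebraMap A B t) htΓ
  have hdvd : Algebra.intNorm A B f ∣
      (t ^ k) ^ Module.finrank (FractionRing A) (FractionRing B) := by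
    obtain ⟨c, hc⟩ := hk
    have hN : Algebra.intNorm A B (algebraMap A B (t ^ k)) =
        (t ^ k) ^ Module.finrank (FractionRing A) (FractionRing B) := by
      apply IsFractionRing.injective A (FractionRing A)
      rw [Algebra.algebraMap_intNorm_fractionRing,
        ← IsScalarTower.algebraMap_apply A B (FractionRing B),
        IsScalarTower.algebraMap_apply A (FractionRing A) (FractionRing B), Algebra.norm_algebraMap,
        map_pow, map_pow, map_pow]
    rw [← hN, map_pow, hc, map_mul]
    exact dvd_mul_right _ _
  intro h
  exact htQ (Q.isPrime.mem_of_pow_mem _ (Q.isPrime.mem_of_pow_mem _ (Ideal.mem_of_dvd _ hdvd h)))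

/-- Pulling back along a finite morphism multiplies the length of the intersection of two divisors
by the degree. -/
theorem finrank_mul_localLength [IsLocalRing A] [IsLocalRing B] (hA : ringKrullDim A = 2)
    {Γ₁ Γ₂ : PrimeDivisor B} (hne : Γ₁ ≠ Γ₂)
    (hpre₁ : specMap A B ⁻¹' (Γ₁.image hφ).carrier = Γ₁.carrier)
    (hpre₂ : specMap A B ⁻¹' (Γ₂.image hφ).carrier = Γ₂.carrier)
    {m n : ℕ} (hn : 0 < n) {f g : A} (hf : IsDefinedBy (m • (Γ₁.image hφ).toWeil) f)
    (hg : IsDefinedBy (n • (Γ₂.image hφ).toWeil) g) :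
    Module.finrank A B * localLength f g =
      (IsLocalRing.maximalIdeal B).inertiaDeg A *
        localLength (algebraMap A B f) (algebraMap A B g) := by
  have := faithfulSMul_of_denseRange hφ
  have hne' : Γ₁.image hφ ≠ Γ₂.image hφ := fun h ↦ hne (PrimeDivisor.eq_of_image_eq hφ hpre₂ h)
  -- The length formula over `A` with `M = B`. That `f, g` is regular on `B` comes from the
  -- normality of `B`, their pullbacks defining multiples of distinct prime divisors.
  have hlen := hf.length_eq hA hne' hn hg (M := B)
    (fun x y h ↦ by
      rw [Algebra.smul_def, Algebra.smul_def] at h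
      simp only [Algebra.smul_def]
      exact (hf.pullback hφ hpre₁).dvd_of_mul_eq_mul hne (hg.pullback hφ hpre₂) h)
    (Ideal.Quotient.mkₐ A (Ideal.span {algebraMap A B f, algebraMap A B g})).toLinearMap
    Ideal.Quotient.mk_surjective fun x ↦ by
      rw [AlgHom.toLinearMap_apply, Ideal.Quotient.mkₐ_eq_mk, Ideal.Quotient.eq_zero_iff_mem,
        Ideal.mem_span_pair]
      simp only [Algebra.smul_def, mul_comm, eq_comm]
  have hloc : IsLocalHom (algebraMap A B) := inferInstance
  have hlies : (IsLocalRing.maximalIdeal B).LiesOver (IsLocalRing.maximalIdeal A) := inferInstance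
  -- Restricting scalars from `B` to `A` multiplies lengths by `[k(w):k(z)]`.
  rw [hf.localLength_eq hA hne' hn hg, ← mul_assoc, ← hlen, localLength,
    IsLocalRing.length_restrictScalars A B, ENat.toNat_mul, mul_comm,
    Ideal.inertiaDeg_eq_of_isMaximal (IsLocalRing.maximalIdeal A), Module.length_eq_finrank,
    ENat.toNat_natCast]
  rfl

end LocalSurface

/-! ### The projection formula -/

open LocalSurface

theorem mainTheorem10
    {A B : Type*} [CommRing A] [IsDomain A] [IsLocalRing A] [IsNoetherianRing A]
    [IsIntegrallyClosed A] (hA : ringKrullDim A = 2)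
    [CommRing B] [IsDomain B] [IsLocalRing B] [IsNoetherianRing B]
    [IsIntegrallyClosed B] (hB : ringKrullDim B = 2)
    [Algebra A B] [Module.Finite A B] (hφ : DenseRange (specMap A B))
    (K L : Type*) [Field K] [Algebra A K] [IsFractionRing A K]
    [Field L] [Algebra B L] [IsFractionRing B L]
    [Algebra K L] [Algebra A L] [IsScalarTower A B L] [IsScalarTower A K L]
    (Γ₁ Γ₂ : PrimeDivisor B) (hne : Γ₁ ≠ Γ₂)
    (hΓ₁ : IsQCartier Γ₁.toWeil) (hΓ₂ : IsQCartier Γ₂.toWeil)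
    (hpre₁ : specMap A B ⁻¹' (Γ₁.image hφ).carrier = Γ₁.carrier)
    (hpre₂ : specMap A B ⁻¹' (Γ₂.image hφ).carrier = Γ₂.carrier) :
    IsQCartier (Γ₁.image hφ).toWeil ∧ IsQCartier (Γ₂.image hφ).toWeil ∧
    (Module.finrank K L : ℚ) *
        intersectionNumber (Γ₁.image hφ).toWeil (Γ₂.image hφ).toWeil =
      (Γ₁.point.asIdeal.ramificationIdx A : ℚ) * (Γ₂.point.asIdeal.ramificationIdx A : ℚ) *
        ((IsLocalRing.maximalIdeal B).inertiaDeg A : ℚ) *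
        intersectionNumber Γ₁.toWeil Γ₂.toWeil := by
  have := faithfulSMul_of_denseRange hφ
  obtain ⟨m₁, hm₁, f₁, hf₁⟩ := hΓ₁.exists_isDefinedBy
  obtain ⟨m₂, hm₂, f₂, hf₂⟩ := hΓ₂.exists_isDefinedBy
  obtain ⟨n₁, hn₁, g₁, hg₁⟩ := hf₁.exists_image hφ hm₁
  obtain ⟨n₂, hn₂, g₂, hg₂⟩ := hf₂.exists_image hφ hm₂
  refine ⟨⟨n₁, hn₁, hg₁.isCartier⟩, ⟨n₂, hn₂, hg₂.isCartier⟩, ?_⟩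
  have hne' : Γ₁.image hφ ≠ Γ₂.image hφ := fun h ↦ hne (PrimeDivisor.eq_of_image_eq hφ hpre₂ h)
  have he₁ := Γ₁.point.asIdeal.ramificationIdx_pos A
  have he₂ := Γ₂.point.asIdeal.ramificationIdx_pos A
  -- Both intersection numbers are evaluated on `g₁, g₂`: downstairs with multiplicities `nᵢ`,
  -- upstairs with `eᵢnᵢ`.
  rw [intersectionNumber_eq hA hne' hn₁ hn₂ hg₁ hg₂,
    intersectionNumber_eq hB hne (Nat.mul_pos he₁ hn₁) (Nat.mul_pos he₂ hn₂)
      (hg₁.pullback hφ hpre₁) (hg₂.pullback hφ hpre₂),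
    IsFractionRing.finrank_eq A K B L]
  have key : (Module.finrank A B : ℚ) * localLength g₁ g₂ =
      (IsLocalRing.maximalIdeal B).inertiaDeg A *
        localLength (algebraMap A B g₁) (algebraMap A B g₂) := by
    exact_mod_cast finrank_mul_localLength hφ hA hne hpre₁ hpre₂ hn₂ hg₁ hg₂
  rw [← mul_div_assoc, key]
  have h₁ : (n₁ : ℚ) ≠ 0 := by positivity
  have h₂ : (n₂ : ℚ) ≠ 0 := by positivity
  have h₃ : (Γ₁.point.asIdeal.ramificationIdx A : ℚ) ≠ 0 := by positivity
  have h₄ : (Γ₂.point.asIdeal.ramificationIdx A : ℚ) ≠ 0 := by positivity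
  push_cast
  field_simp
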